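/- Let $\nu$ be a Lévy measure on $\mathbb{R}$, that is, a Borel measure with $\nu(\{0\})=0$ and $\int_{\mathbb{R}}(|x|^2\wedge 1)\,\nu(dx)<\infty$, let $\delta\in\mathbb{R}$, and let $X$ be a real random variable whose law is infinitely divisible without Gaussian part, with centering constant $\delta$ and Lévy measure $\nu$; that is, its characteristic function is $$ E\big[e^{itX}\big]=\exp\Big\{i\delta t+\int_{\mathbb{R}}\big(e^{itx}-1-itx\,\mathbf 1_{\{|x|\le 1\}}\big)\,\nu(dx)\Big\},\qquad t\in\mathbb{R}. $$ Then for every $0<\gamma<2$, $$ E\big[|X|^\gamma\big]<\infty\quad\Longleftrightarrow\quad\int_{|x|>1}|x|^\gamma\,\nu(dx)<\infty . $$ -/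

import Mathlib

open MeasureTheory

/-- A Borel measure `ν` on `ℝ` is a Lévy measure: `ν({0}) = 0` and `∫ (|x|² ∧ 1) ν(dx) < ∞`. -/
structure IsLevyMeasure (ν : Measure ℝ) : Prop where
  zero_singleton : ν {0} = 0
  lintegral_lt_top : ∫⁻ x, ENNReal.ofReal (min (|x| ^ 2) 1) ∂ν < ⊤

/-- The characteristic exponent without Gaussian part
`i δ t + ∫ (e^{i t x} - 1 - i t x 1_{|x| ≤ 1}) ν(dx)`.
For a Lévy measure `ν` the integrand is `ν`-integrable (it is `O(|x|² ∧ 1)` for each fixed `t`). -/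
noncomputable def levyExponent (δ : ℝ) (ν : Measure ℝ) (t : ℝ) : ℂ :=
  Complex.I * δ * t +
    ∫ x : ℝ, (Complex.exp (Complex.I * t * x) - 1 -
      Set.indicator {y : ℝ | |y| ≤ 1} (fun y : ℝ => Complex.I * t * y) x) ∂ν

/-- `μ` is the infinitely divisible law on `ℝ` without Gaussian part, with centering constant `δ`
and Lévy measure `ν`: its characteristic function is `t ↦ exp (levyExponent δ ν t)`. -/
structure IsInfDivNoGaussian (μ : Measure ℝ) (δ : ℝ) (ν : Measure ℝ) : Prop where
  isProbabilityMeasure : IsProbabilityMeasure μ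
  isLevyMeasure : IsLevyMeasure ν
  charFun_eq : ∀ t : ℝ, charFun μ t = Complex.exp (levyExponent δ ν t)

/-!
For `0 < γ < 2` the integral `∫ (1 - cos (t x)) t ^ (-1 - γ) dt` over `0 < t ≤ 1` is at most a
constant times `|x| ^ γ`, and at least a constant times `|x| ^ γ` when `|x| ≥ 1` (`cosKernel_le`,
`le_cosKernel`). By Tonelli, a finite measure `m` therefore has a finite absolute moment of order
`γ` if and only if `∫ t in (0, 1], t ^ (-1 - γ) ∫ (1 - cos (t x)) m(dx) dt` is finite
(`lintegral_abs_rpow_lt_top_iff`). This is used for the law of `X`, whose inner integral is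
`1 - Re φ(t)` with `φ = exp ψ` the characteristic function, and for the restriction of `ν` to
`{|x| > 1}`, whose inner integral is called `A(t)`. It remains to compare the two for `0 < t ≤ 1`.

Lower bound (`IsLevyMeasure.le_one_sub_re_exp`): `Re ψ ≤ -A` and `A` is bounded, so
`1 - Re φ ≥ 1 - |φ| ≥ 1 - exp (-A) ≥ c A`.

Upper bound (`IsLevyMeasure.exists_one_sub_re_exp_le`): `1 - Re φ ≤ -Re ψ + (Im ψ) ^ 2 / 2`. The
small jumps contribute `O(t ^ 2)` to `ψ`, and the drift `O(t)` to `Im ψ`. The large jumps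
contribute `A` to `-Re ψ` and `∫ sin (t x) ν(dx)` to `Im ψ`; the square of the latter is `O(A)` by
Cauchy–Schwarz, since `sin u ^ 2 ≤ 2 (1 - cos u)` (`sq_integral_sin_le`). Thus
`1 - Re φ(t) ≤ C t ^ 2 + D A(t)`, and `t ^ 2 t ^ (-1 - γ)` is integrable on `(0, 1]` because
`γ < 2`.
-/

open Set

/-! ### Truncated kernel and absolute moments of finite measures -/

lemma lintegral_Ioc_rpow_one_sub {γ r : ℝ} (hγ₂ : γ < 2) (hr : 0 ≤ r) {c : ℝ} (hc : 0 ≤ c) :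
    ∫⁻ t in Ioc 0 r, ENNReal.ofReal (c * t ^ (1 - γ)) =
      ENNReal.ofReal (c * (r ^ (2 - γ) / (2 - γ))) := by
  have hi : IntegrableOn (fun t : ℝ => c * t ^ (1 - γ)) (Ioc 0 r) := by
    have := (intervalIntegral.intervalIntegrable_rpow' (a := 0) (b := r)
      (show -1 < 1 - γ by linarith)).const_mul c
    exact (intervalIntegrable_iff_integrableOn_Ioc_of_le hr).1 this
  rw [← ofReal_integral_eq_lintegral_ofReal hi
    ((ae_restrict_mem measurableSet_Ioc).mono fun t ht =>
      mul_nonneg hc (Real.rpow_nonneg ht.1.le _)),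
    ← intervalIntegral.integral_of_le hr, intervalIntegral.integral_const_mul,
    integral_rpow (Or.inl (by linarith)), show 1 - γ + 1 = 2 - γ by ring,
    Real.zero_rpow (by linarith), sub_zero]

lemma lintegral_Ioi_rpow_neg_one_sub {γ r : ℝ} (hγ₀ : 0 < γ) (hr : 0 < r) {c : ℝ} (hc : 0 ≤ c) :
    ∫⁻ t in Ioi r, ENNReal.ofReal (c * t ^ (-1 - γ)) =
      ENNReal.ofReal (c * (r ^ (-γ) / γ)) := by
  have hi : IntegrableOn (fun t : ℝ => c * t ^ (-1 - γ)) (Ioi r) :=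
    (integrableOn_Ioi_rpow_of_lt (by linarith) hr).const_mul c
  rw [← ofReal_integral_eq_lintegral_ofReal hi
    ((ae_restrict_mem measurableSet_Ioi).mono fun t ht =>
      mul_nonneg hc (Real.rpow_nonneg (hr.trans ht).le _)),
    integral_const_mul, integral_Ioi_rpow_of_lt (by linarith) hr,
    show -1 - γ + 1 = -γ by ring]
  congr 2
  field_simp

/-- The truncated Marcinkiewicz kernel `∫ t in (0, 1], (1 - cos (t x)) t ^ (-1 - γ)`. Extending the
integral to `(0, ∞)` would give a multiple of `|x| ^ γ`. -/
noncomputable def cosKernel (γ x : ℝ) : ENNReal :=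
  ∫⁻ t in Ioc (0 : ℝ) 1, ENNReal.ofReal (t ^ (-1 - γ)) * ENNReal.ofReal (1 - Real.cos (t * x))

lemma sq_mul_rpow_neg_one_sub {t : ℝ} (ht : 0 < t) (γ : ℝ) :
    t ^ (-1 - γ) * t ^ 2 = t ^ (1 - γ) := by
  rw [← Real.rpow_natCast, ← Real.rpow_add ht]
  congr 1
  push_cast
  ring

lemma sq_mul_inv_abs_rpow {x : ℝ} (hx : x ≠ 0) (γ : ℝ) :
    x ^ 2 * |x|⁻¹ ^ (2 - γ) = |x| ^ γ := by
  have h : 0 < |x| := abs_pos.2 hx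
  rw [Real.inv_rpow h.le, ← Real.rpow_neg h.le, ← sq_abs x, ← Real.rpow_natCast,
    ← Real.rpow_add h]
  congr 1
  push_cast
  ring

/-- The bound comes from splitting at `t = 1 / |x|`, with `1 - cos u ≤ u ^ 2 / 2` below and
`1 - cos u ≤ 2` above. -/
lemma cosKernel_le {γ : ℝ} (hγ₀ : 0 < γ) (hγ₂ : γ < 2) (x : ℝ) :
    cosKernel γ x ≤ ENNReal.ofReal (1 / 2 / (2 - γ) + 2 / γ) * ENNReal.ofReal (|x| ^ γ) := by
  rcases eq_or_ne x 0 with rfl | hx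
  · simp [cosKernel]
  have hx' : 0 < |x| := abs_pos.2 hx
  have h2 : 0 < 2 - γ := by linarith
  set r := |x|⁻¹ with hr
  have hr0 : 0 < r := inv_pos.2 hx'
  have hsub : Ioc (0 : ℝ) 1 ⊆ Ioc 0 r ∪ Ioi r := by
    intro t ht
    rcases le_or_gt t r with h | h
    · exact Or.inl ⟨ht.1, h⟩
    · exact Or.inr h
  unfold cosKernel
  refine (lintegral_mono_set hsub).trans ((lintegral_union_le _ _ _).trans ?_)
  have h1 : ∫⁻ t in Ioc 0 r, ENNReal.ofReal (t ^ (-1 - γ)) *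
      ENNReal.ofReal (1 - Real.cos (t * x)) ≤
      ENNReal.ofReal (1 / 2 / (2 - γ) * |x| ^ γ) := by
    calc _ ≤ ∫⁻ t in Ioc 0 r, ENNReal.ofReal (x ^ 2 / 2 * t ^ (1 - γ)) := by
          refine setLIntegral_mono' measurableSet_Ioc fun t ht => ?_
          rw [← ENNReal.ofReal_mul (Real.rpow_nonneg ht.1.le _)]
          refine ENNReal.ofReal_le_ofReal ?_
          rw [← sq_mul_rpow_neg_one_sub ht.1]
          have := Real.one_sub_sq_div_two_le_cos (x := t * x)
          calc _ ≤ t ^ (-1 - γ) * ((t * x) ^ 2 / 2) := by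
                gcongr
                · exact Real.rpow_nonneg ht.1.le _
                · linarith
            _ = _ := by ring
      _ = _ := by
          rw [lintegral_Ioc_rpow_one_sub hγ₂ hr0.le (by positivity),
            ← sq_mul_inv_abs_rpow hx γ]
          congr 1
          ring
  have h3 : ∫⁻ t in Ioi r, ENNReal.ofReal (t ^ (-1 - γ)) *
      ENNReal.ofReal (1 - Real.cos (t * x)) ≤ ENNReal.ofReal (2 / γ * |x| ^ γ) := by
    calc _ ≤ ∫⁻ t in Ioi r, ENNReal.ofReal (2 * t ^ (-1 - γ)) := by
          refine setLIntegral_mono' measurableSet_Ioi fun t ht => ?_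
          have ht0 : 0 < t := hr0.trans ht
          rw [← ENNReal.ofReal_mul (Real.rpow_nonneg ht0.le _), mul_comm 2]
          refine ENNReal.ofReal_le_ofReal ?_
          gcongr
          linarith [Real.neg_one_le_cos (t * x)]
      _ = _ := by
          rw [lintegral_Ioi_rpow_neg_one_sub hγ₀ hr0 (by norm_num), hr, Real.inv_rpow hx'.le,
            Real.rpow_neg hx'.le, inv_inv]
          congr 1
          ring
  refine (add_le_add h1 h3).trans (le_of_eq ?_)
  rw [← ENNReal.ofReal_add (by positivity) (by positivity), ← ENNReal.ofReal_mul (by positivity),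
    add_mul]

/-- Already the part `t ≤ 1 / |x|` of the kernel, where `1 - cos u` is comparable to `u ^ 2`,
is of order `|x| ^ γ`. -/
lemma le_cosKernel {γ : ℝ} (hγ₂ : γ < 2) {x : ℝ} (hx : 1 ≤ |x|) :
    ENNReal.ofReal (|x| ^ γ) ≤
      ENNReal.ofReal ((2 - γ) * (Real.pi ^ 2 / 2)) * cosKernel γ x := by
  have hx' : 0 < |x| := by linarith
  have hx0 : x ≠ 0 := abs_pos.1 hx'
  have h2 : 0 < 2 - γ := by linarith
  have hpi := Real.pi_pos
  set r := |x|⁻¹ with hr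
  have hr0 : 0 < r := inv_pos.2 hx'
  have key : ENNReal.ofReal (2 / Real.pi ^ 2 / (2 - γ) * |x| ^ γ) ≤ cosKernel γ x := by
    calc _ = ∫⁻ t in Ioc 0 r, ENNReal.ofReal (2 / Real.pi ^ 2 * x ^ 2 * t ^ (1 - γ)) := by
          rw [lintegral_Ioc_rpow_one_sub hγ₂ hr0.le (by positivity),
            ← sq_mul_inv_abs_rpow hx0 γ]
          congr 1
          ring
      _ ≤ ∫⁻ t in Ioc 0 r, ENNReal.ofReal (t ^ (-1 - γ)) *
            ENNReal.ofReal (1 - Real.cos (t * x)) := by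
          refine setLIntegral_mono' measurableSet_Ioc fun t ht => ?_
          rw [← ENNReal.ofReal_mul (Real.rpow_nonneg ht.1.le _)]
          refine ENNReal.ofReal_le_ofReal ?_
          rw [← sq_mul_rpow_neg_one_sub ht.1]
          have habs : |t * x| ≤ 1 := by
            rw [abs_mul, abs_of_pos ht.1]
            calc t * |x| ≤ r * |x| := by gcongr; exact ht.2
              _ = 1 := inv_mul_cancel₀ hx'.ne'
          have := Real.cos_le_one_sub_mul_cos_sq
            (x := t * x) (habs.trans (by linarith [Real.pi_gt_three]))
          calc _ = t ^ (-1 - γ) * (2 / Real.pi ^ 2 * (t * x) ^ 2) := by ring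
            _ ≤ _ := by
                gcongr
                · exact Real.rpow_nonneg ht.1.le _
                · linarith
      _ ≤ cosKernel γ x :=
          lintegral_mono_set (Ioc_subset_Ioc_right (inv_le_one_of_one_le₀ hx))
  refine le_trans (le_of_eq ?_) (mul_le_mul_right key _)
  rw [← ENNReal.ofReal_mul (by positivity)]
  congr 1
  field_simp

lemma integrable_one_sub_cos (m : Measure ℝ) [IsFiniteMeasure m] (t : ℝ) :
    Integrable (fun x => 1 - Real.cos (t * x)) m :=
  Integrable.of_bound (C := 2) (by fun_prop) (ae_of_all _ fun x => by
    rw [Real.norm_eq_abs, abs_le]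
    constructor <;> linarith [Real.neg_one_le_cos (t * x), Real.cos_le_one (t * x)])

/-- The behaviour near `0` of the real part of the Fourier transform of a finite measure decides
which absolute moments of order less than `2` are finite. -/
lemma lintegral_abs_rpow_lt_top_iff (m : Measure ℝ) [IsFiniteMeasure m] {γ : ℝ}
    (hγ₀ : 0 < γ) (hγ₂ : γ < 2) :
    ∫⁻ x, ENNReal.ofReal (|x| ^ γ) ∂m < ⊤ ↔
      ∫⁻ t in Ioc (0 : ℝ) 1, ENNReal.ofReal (t ^ (-1 - γ)) *
        ENNReal.ofReal (∫ x, (1 - Real.cos (t * x)) ∂m) < ⊤ := by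
  have hT : ∫⁻ t in Ioc (0 : ℝ) 1, ENNReal.ofReal (t ^ (-1 - γ)) *
        ENNReal.ofReal (∫ x, (1 - Real.cos (t * x)) ∂m) = ∫⁻ x, cosKernel γ x ∂m := by
    unfold cosKernel
    rw [lintegral_lintegral_swap (by fun_prop)]
    refine lintegral_congr fun t => ?_
    rw [lintegral_const_mul _ (by fun_prop), ofReal_integral_eq_lintegral_ofReal
      (integrable_one_sub_cos m t)
      (ae_of_all _ fun x => sub_nonneg.2 (Real.cos_le_one _))]
  rw [hT]
  constructor
  · intro h
    refine (lintegral_mono (cosKernel_le hγ₀ hγ₂)).trans_lt ?_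
    rw [lintegral_const_mul' _ _ ENNReal.ofReal_ne_top]
    exact ENNReal.mul_lt_top ENNReal.ofReal_lt_top h
  · intro h
    have hb : ∀ x : ℝ, ENNReal.ofReal (|x| ^ γ) ≤
        1 + ENNReal.ofReal ((2 - γ) * (Real.pi ^ 2 / 2)) * cosKernel γ x := by
      intro x
      rcases le_total |x| 1 with hx | hx
      · refine le_trans ?_ le_self_add
        rw [ENNReal.ofReal_le_one]
        exact Real.rpow_le_one (abs_nonneg _) hx hγ₀.le
      · exact (le_cosKernel hγ₂ hx).trans le_add_self
    refine (lintegral_mono hb).trans_lt ?_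
    rw [lintegral_add_left measurable_const, lintegral_const_mul' _ _ ENNReal.ofReal_ne_top]
    exact ENNReal.add_lt_top.2 ⟨by simp, ENNReal.mul_lt_top ENNReal.ofReal_lt_top h⟩

/-- Cauchy–Schwarz together with `sin u ^ 2 ≤ 2 (1 - cos u)`. -/
lemma sq_integral_sin_le (m : Measure ℝ) [IsFiniteMeasure m] (t : ℝ) :
    (∫ x, Real.sin (t * x) ∂m) ^ 2 ≤
      2 * m.real univ * ∫ x, (1 - Real.cos (t * x)) ∂m := by
  have hs : Integrable (fun x => Real.sin (t * x)) m :=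
    Integrable.of_bound (C := 1) (by fun_prop) (ae_of_all _ fun x => Real.abs_sin_le_one _)
  have hs2 : Integrable (fun x => Real.sin (t * x) ^ 2) m :=
    Integrable.of_bound (C := 1) (by fun_prop) (ae_of_all _ fun x => by
      rw [norm_pow]; exact pow_le_one₀ (norm_nonneg _) (Real.abs_sin_le_one _))
  set M := m.real univ with hM
  set B := ∫ x, Real.sin (t * x) ∂m with hB
  have hA : ∫ x, Real.sin (t * x) ^ 2 ∂m ≤ 2 * ∫ x, (1 - Real.cos (t * x)) ∂m := by
    rw [← integral_const_mul]
    refine integral_mono hs2 ((integrable_one_sub_cos m t).const_mul 2) fun x => ?_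
    nlinarith [Real.sin_sq_add_cos_sq (t * x), sq_nonneg (1 - Real.cos (t * x))]
  have hM0 : 0 ≤ M := measureReal_nonneg
  rcases hM0.eq_or_lt with h0 | h0
  · have : m = 0 := by
      rw [← Measure.measure_univ_eq_zero]
      exact (measureReal_eq_zero_iff).1 h0.symm
    simp [hB, this]
  -- expand `0 ≤ ∫ (M sin (t x) - B) ^ 2`, whose value is `M (M ∫ sin (t x) ^ 2 - B ^ 2)`
  have hsq : 0 ≤ ∫ x, (M * Real.sin (t * x) - B) ^ 2 ∂m :=
    integral_nonneg fun x => sq_nonneg _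
  have hexp : ∫ x, (M * Real.sin (t * x) - B) ^ 2 ∂m =
      M ^ 2 * ∫ x, Real.sin (t * x) ^ 2 ∂m - 2 * M * B * B + B ^ 2 * M := by
    have : ∀ x, (M * Real.sin (t * x) - B) ^ 2 =
        M ^ 2 * Real.sin (t * x) ^ 2 - 2 * M * B * Real.sin (t * x) + B ^ 2 := fun x => by ring
    simp_rw [this]
    rw [integral_add (f := fun x => M ^ 2 * Real.sin (t * x) ^ 2 - 2 * M * B * Real.sin (t * x))
        ((hs2.const_mul _).sub (hs.const_mul _)) (integrable_const _),
      integral_sub (hs2.const_mul _) (hs.const_mul _), integral_const_mul, integral_const_mul,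
      integral_const, smul_eq_mul, ← hM, mul_comm M (B ^ 2)]
  have : 0 ≤ M * (M * ∫ x, Real.sin (t * x) ^ 2 ∂m - B ^ 2) := by
    calc _ ≤ _ := hsq
      _ = _ := by rw [hexp]; ring
  have := nonneg_of_mul_nonneg_right this h0
  nlinarith

/-! ### Small and large jumps -/

/-- The part of `ν` carried by the large jumps. -/
noncomputable def bigJumps (ν : Measure ℝ) : Measure ℝ := ν.restrict {x | 1 < |x|}

lemma measurableSet_one_lt_abs : MeasurableSet {x : ℝ | 1 < |x|} :=
  measurableSet_lt measurable_const (by fun_prop)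

lemma measurableSet_abs_le_one : MeasurableSet {x : ℝ | |x| ≤ 1} :=
  measurableSet_le (by fun_prop) measurable_const

lemma IsLevyMeasure.isFiniteMeasure_bigJumps {ν : Measure ℝ} (h : IsLevyMeasure ν) :
    IsFiniteMeasure (bigJumps ν) := by
  refine ⟨lt_of_le_of_lt ?_ h.lintegral_lt_top⟩
  rw [bigJumps, Measure.restrict_apply_univ, ← setLIntegral_one]
  refine (setLIntegral_mono' measurableSet_one_lt_abs fun x hx => ?_).trans
    (setLIntegral_le_lintegral _ _)
  rw [mem_ofPred_eq] at hx
  rw [min_eq_right (one_le_pow₀ hx.le), ENNReal.ofReal_one]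

lemma IsLevyMeasure.integrableOn_sq {ν : Measure ℝ} (h : IsLevyMeasure ν) :
    IntegrableOn (fun x => x ^ 2) {x | |x| ≤ 1} ν := by
  refine ⟨by fun_prop, ?_⟩
  rw [hasFiniteIntegral_iff_ofReal (ae_of_all _ fun x => sq_nonneg x)]
  refine lt_of_le_of_lt ?_ h.lintegral_lt_top
  refine (setLIntegral_mono' measurableSet_abs_le_one fun x hx => ?_).trans
    (setLIntegral_le_lintegral _ _)
  rw [mem_ofPred_eq] at hx
  rw [min_eq_left (pow_le_one₀ (abs_nonneg _) hx), sq_abs]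

/-- The contribution of the jumps `|x| ≤ 1` to the exponent, with the compensator `i t x`. -/
noncomputable def smallJumpExponent (ν : Measure ℝ) (t : ℝ) : ℂ :=
  ∫ x in {x : ℝ | |x| ≤ 1}, (Complex.exp (Complex.I * t * x) - 1 - Complex.I * t * x) ∂ν

lemma norm_exp_sub_one_sub_le_sq {t x : ℝ} (ht : t ∈ Ioc (0 : ℝ) 1) (hx : |x| ≤ 1) :
    ‖Complex.exp (Complex.I * t * x) - 1 - Complex.I * t * x‖ ≤ t ^ 2 * x ^ 2 := by
  have hn : ‖Complex.I * t * x‖ = t * |x| := by simp [abs_of_pos ht.1]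
  refine (Complex.norm_exp_sub_one_sub_id_le ?_).trans (le_of_eq ?_)
  · rw [hn]
    exact mul_le_one₀ ht.2 (abs_nonneg _) hx
  · rw [hn, mul_pow, sq_abs]

lemma IsLevyMeasure.integrableOn_small {ν : Measure ℝ} (h : IsLevyMeasure ν) {t : ℝ}
    (ht : t ∈ Ioc (0 : ℝ) 1) :
    IntegrableOn (fun x : ℝ => Complex.exp (Complex.I * t * x) - 1 - Complex.I * t * x)
      {x | |x| ≤ 1} ν :=
  (h.integrableOn_sq.const_mul (t ^ 2)).mono' (by fun_prop)
    ((ae_restrict_mem measurableSet_abs_le_one).mono fun _ hx =>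
      norm_exp_sub_one_sub_le_sq ht hx)

lemma IsLevyMeasure.norm_smallJumpExponent_le {ν : Measure ℝ} (h : IsLevyMeasure ν) {t : ℝ}
    (ht : t ∈ Ioc (0 : ℝ) 1) :
    ‖smallJumpExponent ν t‖ ≤ t ^ 2 * ∫ x in {x : ℝ | |x| ≤ 1}, x ^ 2 ∂ν := by
  rw [← integral_const_mul]
  exact norm_integral_le_of_norm_le (h.integrableOn_sq.const_mul (t ^ 2))
    ((ae_restrict_mem measurableSet_abs_le_one).mono fun _ hx =>
      norm_exp_sub_one_sub_le_sq ht hx)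

lemma exp_I_mul_mul (t x : ℝ) : Complex.exp (Complex.I * t * x) =
    (Real.cos (t * x) : ℂ) + Real.sin (t * x) * Complex.I := by
  rw [mul_assoc, mul_comm Complex.I, Complex.exp_mul_I]
  push_cast
  rfl

lemma IsLevyMeasure.re_smallJumpExponent_nonpos {ν : Measure ℝ} (h : IsLevyMeasure ν) {t : ℝ}
    (ht : t ∈ Ioc (0 : ℝ) 1) : (smallJumpExponent ν t).re ≤ 0 := by
  rw [smallJumpExponent, ← RCLike.re_eq_complex_re, ← integral_re (h.integrableOn_small ht)]
  refine integral_nonpos fun x => ?_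
  simp only [exp_I_mul_mul, RCLike.re_eq_complex_re]
  simp [-Complex.ofReal_cos, -Complex.ofReal_sin, Real.cos_le_one]

lemma integrable_exp_sub_one (m : Measure ℝ) [IsFiniteMeasure m] (t : ℝ) :
    Integrable (fun x : ℝ => Complex.exp (Complex.I * t * x) - 1) m := by
  refine Integrable.sub ?_ (integrable_const _)
  refine Integrable.of_bound (C := 1) (by fun_prop) (ae_of_all _ fun x => ?_)
  rw [show Complex.I * t * x = ((t * x : ℝ) : ℂ) * Complex.I by push_cast; ring,
    Complex.norm_exp_ofReal_mul_I]

lemma IsLevyMeasure.levyExponent_eq {ν : Measure ℝ} (h : IsLevyMeasure ν) (δ : ℝ) {t : ℝ}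
    (ht : t ∈ Ioc (0 : ℝ) 1) :
    levyExponent δ ν t = Complex.I * δ * t + smallJumpExponent ν t +
      ∫ x : ℝ, (Complex.exp (Complex.I * t * x) - 1) ∂(bigJumps ν) := by
  have := h.isFiniteMeasure_bigJumps
  have hc : {x : ℝ | |x| ≤ 1}ᶜ = {x | 1 < |x|} := by ext; simp
  have e1 : ∀ x ∈ {x : ℝ | |x| ≤ 1}, Complex.exp (Complex.I * t * x) - 1 - Complex.I * t * x =
      Complex.exp (Complex.I * t * x) - 1 -
      indicator {y : ℝ | |y| ≤ 1} (fun y : ℝ => Complex.I * t * y) x := fun x hx => by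
    rw [indicator_of_mem hx]
  have e2 : ∀ x ∈ {x : ℝ | 1 < |x|}, Complex.exp (Complex.I * t * x) - 1 =
      Complex.exp (Complex.I * t * x) - 1 -
      indicator {y : ℝ | |y| ≤ 1} (fun y : ℝ => Complex.I * t * y) x := fun x hx => by
    rw [indicator_of_notMem (by simpa using hx), sub_zero]
  have i1 := (h.integrableOn_small ht).congr_fun e1 measurableSet_abs_le_one
  have i2 := IntegrableOn.congr_fun (integrable_exp_sub_one (bigJumps ν) t) e2
    measurableSet_one_lt_abs
  rw [← hc] at i2
  rw [levyExponent, ← integral_add_compl measurableSet_abs_le_one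
    ((integrableOn_univ).1 (by
      rw [← union_compl_self {x : ℝ | |x| ≤ 1}]; exact i1.union i2)),
    hc, smallJumpExponent, bigJumps, setIntegral_congr_fun measurableSet_abs_le_one e1,
    setIntegral_congr_fun measurableSet_one_lt_abs e2, add_assoc]

lemma integral_exp_sub_one (m : Measure ℝ) [IsFiniteMeasure m] (t : ℝ) :
    ∫ x : ℝ, (Complex.exp (Complex.I * t * x) - 1) ∂m =
      ⟨-∫ x, (1 - Real.cos (t * x)) ∂m, ∫ x, Real.sin (t * x) ∂m⟩ := by
  have hi := integrable_exp_sub_one m t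
  apply Complex.ext
  · rw [← RCLike.re_eq_complex_re, ← integral_re hi, RCLike.re_eq_complex_re]
    rw [← integral_neg]
    refine integral_congr_ae (ae_of_all _ fun x => ?_)
    simp [exp_I_mul_mul, -Complex.ofReal_cos, -Complex.ofReal_sin]
  · rw [← RCLike.im_eq_complex_im, ← integral_im hi, RCLike.im_eq_complex_im]
    refine integral_congr_ae (ae_of_all _ fun x => ?_)
    simp [exp_I_mul_mul, -Complex.ofReal_cos, -Complex.ofReal_sin]

lemma integral_one_sub_cos_eq (μ : Measure ℝ) [IsProbabilityMeasure μ] (t : ℝ) :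
    ∫ x, (1 - Real.cos (t * x)) ∂μ = 1 - (charFun μ t).re := by
  have h := congrArg Complex.re (integral_exp_sub_one μ t)
  have hi : Integrable (fun x : ℝ => Complex.exp (Complex.I * t * x)) μ := by
    refine ((integrable_exp_sub_one μ t).add (integrable_const (1 : ℂ))).congr
      (ae_of_all _ fun x => ?_)
    simp
  rw [integral_sub hi (integrable_const _)] at h
  have hc : charFun μ t = ∫ x : ℝ, Complex.exp (Complex.I * t * x) ∂μ := by
    rw [charFun_apply_real]
    refine integral_congr_ae (ae_of_all _ fun x => ?_)
    simp only
    congr 1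
    ring
  rw [← hc] at h
  simp at h
  linarith

/-! ### The characteristic function near zero -/

/-- `|exp z| ≤ exp (Re z)`, followed by `1 - exp (-A) ≥ A exp (-A)`. -/
lemma mul_exp_neg_le_one_sub_re_exp {z : ℂ} {A M : ℝ} (hA : 0 ≤ A) (hAM : A ≤ M)
    (hz : z.re ≤ -A) : A * Real.exp (-M) ≤ 1 - (Complex.exp z).re := by
  have h1 : (Complex.exp z).re ≤ Real.exp (-A) :=
    (Complex.re_le_norm _).trans (by rw [Complex.norm_exp]; exact Real.exp_le_exp.2 hz)
  have h2 : A * Real.exp (-M) ≤ A * Real.exp (-A) := by gcongr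
  have h3 : (A + 1) * Real.exp (-A) ≤ 1 := by
    calc _ ≤ Real.exp A * Real.exp (-A) := by gcongr; exact Real.add_one_le_exp A
      _ = 1 := by rw [← Real.exp_add]; simp
  linarith

lemma one_sub_re_exp_le {z : ℂ} (hz : z.re ≤ 0) :
    1 - (Complex.exp z).re ≤ -z.re + z.im ^ 2 / 2 := by
  rw [Complex.exp_re]
  have h1 := Real.add_one_le_exp z.re
  have h2 : Real.exp z.re ≤ 1 := Real.exp_le_one_iff.2 hz
  have h3 := Real.one_sub_sq_div_two_le_cos (x := z.im)
  have h4 := Real.exp_pos z.re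
  nlinarith [Real.cos_le_one z.im, sq_nonneg z.im]

/-- Near `0`, `1 - Re exp ψ` is bounded below by the large-jump integral of `1 - cos (t x)`. -/
lemma IsLevyMeasure.le_one_sub_re_exp {ν : Measure ℝ} (h : IsLevyMeasure ν) (δ : ℝ) {t : ℝ}
    (ht : t ∈ Ioc (0 : ℝ) 1) :
    (∫ x, (1 - Real.cos (t * x)) ∂(bigJumps ν)) * Real.exp (-(2 * (bigJumps ν).real univ)) ≤
      1 - (Complex.exp (levyExponent δ ν t)).re := by
  have := h.isFiniteMeasure_bigJumps
  refine mul_exp_neg_le_one_sub_re_exp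
    (integral_nonneg fun x => sub_nonneg.2 (Real.cos_le_one _)) ?_ ?_
  · calc _ ≤ ∫ _, (2 : ℝ) ∂(bigJumps ν) :=
          integral_mono (integrable_one_sub_cos _ t) (integrable_const _) fun x => by
            simp only
            linarith [Real.neg_one_le_cos (t * x)]
      _ = _ := by rw [integral_const, smul_eq_mul, mul_comm]
  · rw [h.levyExponent_eq δ ht, integral_exp_sub_one]
    have := h.re_smallJumpExponent_nonpos ht
    simp
    linarith

/-- Near `0`, `1 - Re exp ψ` is bounded above, up to a term of order `t ^ 2`, by the large-jump
integral of `1 - cos (t x)`. -/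
lemma IsLevyMeasure.exists_one_sub_re_exp_le {ν : Measure ℝ} (h : IsLevyMeasure ν) (δ : ℝ) :
    ∃ C D : ℝ, 0 ≤ C ∧ 0 ≤ D ∧ ∀ t ∈ Ioc (0 : ℝ) 1,
      1 - (Complex.exp (levyExponent δ ν t)).re ≤
        C * t ^ 2 + D * ∫ x, (1 - Real.cos (t * x)) ∂(bigJumps ν) := by
  have := h.isFiniteMeasure_bigJumps
  set S := ∫ x in {x : ℝ | |x| ≤ 1}, x ^ 2 ∂ν with hS
  set M := (bigJumps ν).real univ with hM
  have hS0 : 0 ≤ S := integral_nonneg fun x => sq_nonneg x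
  have hM0 : 0 ≤ M := measureReal_nonneg
  refine ⟨S + 3 / 2 * (δ ^ 2 + S ^ 2), 1 + 3 * M, by positivity, by positivity, fun t ht => ?_⟩
  set A := ∫ x, (1 - Real.cos (t * x)) ∂(bigJumps ν) with hA
  set B := ∫ x, Real.sin (t * x) ∂(bigJumps ν) with hB
  set s := smallJumpExponent ν t with hs
  have hA0 : 0 ≤ A := integral_nonneg fun x => sub_nonneg.2 (Real.cos_le_one _)
  have hBA : B ^ 2 ≤ 2 * M * A := sq_integral_sin_le _ t
  have hn : ‖s‖ ≤ t ^ 2 * S := h.norm_smallJumpExponent_le ht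
  have hs0 : s.re ≤ 0 := h.re_smallJumpExponent_nonpos ht
  have hre : (levyExponent δ ν t).re = s.re - A := by
    rw [h.levyExponent_eq δ ht, integral_exp_sub_one]
    simp
    ring
  have him : (levyExponent δ ν t).im = δ * t + s.im + B := by
    rw [h.levyExponent_eq δ ht, integral_exp_sub_one]
    simp [hs, hB]
  refine (one_sub_re_exp_le (by rw [hre]; linarith)).trans ?_
  rw [hre, him]
  have h1 : -s.re ≤ t ^ 2 * S := (neg_le_abs _).trans ((Complex.abs_re_le_norm s).trans hn)
  have h2 : s.im ^ 2 ≤ t ^ 2 * S ^ 2 := by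
    have h3 : |s.im| ≤ t * S := (Complex.abs_im_le_norm s).trans (hn.trans (by
      gcongr
      nlinarith [ht.1, ht.2]))
    calc s.im ^ 2 = |s.im| ^ 2 := (sq_abs _).symm
      _ ≤ (t * S) ^ 2 := by gcongr
      _ = _ := by ring
  -- `(x + y + z) ^ 2 ≤ 3 (x ^ 2 + y ^ 2 + z ^ 2)` for the three terms of the imaginary part
  nlinarith [sq_nonneg (δ * t - s.im), sq_nonneg (δ * t - B), sq_nonneg (s.im - B)]

theorem lemma2p1 {Ω : Type*} [MeasurableSpace Ω] (P : Measure Ω) [IsProbabilityMeasure P]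
    (X : Ω → ℝ) (hX : AEMeasurable X P) (δ : ℝ) (ν : Measure ℝ)
    (hXν : IsInfDivNoGaussian (P.map X) δ ν) (γ : ℝ) (hγ₀ : 0 < γ) (hγ₂ : γ < 2) :
    (∫⁻ ω, ENNReal.ofReal (|X ω| ^ γ) ∂P < ⊤) ↔
      (∫⁻ x in {x : ℝ | 1 < |x|}, ENNReal.ofReal (|x| ^ γ) ∂ν < ⊤) := by
  have hν := hXν.isLevyMeasure
  have := hXν.isProbabilityMeasure
  have := hν.isFiniteMeasure_bigJumps
  rw [← lintegral_map' (f := fun x : ℝ => ENNReal.ofReal (|x| ^ γ)) (by fun_prop) hX,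
    lintegral_abs_rpow_lt_top_iff _ hγ₀ hγ₂, ← bigJumps,
    lintegral_abs_rpow_lt_top_iff _ hγ₀ hγ₂]
  simp_rw [integral_one_sub_cos_eq, hXν.charFun_eq]
  constructor
  · intro h
    refine lt_of_le_of_lt ?_ (ENNReal.mul_lt_top
      (a := ENNReal.ofReal (Real.exp (2 * (bigJumps ν).real univ))) ENNReal.ofReal_lt_top h)
    rw [← lintegral_const_mul' _ _ ENNReal.ofReal_ne_top]
    refine setLIntegral_mono' measurableSet_Ioc fun t ht => ?_
    rw [mul_left_comm, ← ENNReal.ofReal_mul (Real.exp_pos _).le]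
    gcongr
    have := mul_le_mul_of_nonneg_left (hν.le_one_sub_re_exp δ ht)
      (Real.exp_pos (2 * (bigJumps ν).real univ)).le
    rwa [mul_left_comm, ← Real.exp_add, add_neg_cancel, Real.exp_zero, mul_one] at this
  · intro h
    obtain ⟨C, D, hC, hD, hCD⟩ := hν.exists_one_sub_re_exp_le δ
    have hle : ∀ t ∈ Ioc (0 : ℝ) 1, ENNReal.ofReal (t ^ (-1 - γ)) *
        ENNReal.ofReal (1 - (Complex.exp (levyExponent δ ν t)).re) ≤
        ENNReal.ofReal (C * t ^ (1 - γ)) + ENNReal.ofReal D * (ENNReal.ofReal (t ^ (-1 - γ)) *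
          ENNReal.ofReal (∫ x, (1 - Real.cos (t * x)) ∂(bigJumps ν))) := fun t ht => by
      refine (mul_le_mul_right (ENNReal.ofReal_le_ofReal (hCD t ht)) _).trans ?_
      refine (mul_le_mul_right ENNReal.ofReal_add_le _).trans (le_of_eq ?_)
      rw [mul_add, ← sq_mul_rpow_neg_one_sub ht.1, ENNReal.ofReal_mul hD, mul_left_comm C,
        ENNReal.ofReal_mul (Real.rpow_nonneg ht.1.le _), mul_left_comm (ENNReal.ofReal D)]
    refine (setLIntegral_mono' measurableSet_Ioc hle).trans_lt ?_
    rw [lintegral_add_left (by fun_prop), lintegral_Ioc_rpow_one_sub hγ₂ zero_le_one hC,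
      lintegral_const_mul' _ _ ENNReal.ofReal_ne_top]
    exact ENNReal.add_lt_top.2 ⟨ENNReal.ofReal_lt_top, ENNReal.mul_lt_top ENNReal.ofReal_lt_top h⟩
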